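/- For probability distributions $\eta,\rho$ on $\mathbb{R}$ let $\eta*\rho$ denote their convolution, $\rho^{n*}$ the $n$-th convolution power ($n\ge 1$), and $\bar\rho(x):=\rho((x,\infty))$ the tail. Write $f(x)\sim g(x)$ if $\lim_{x\to\infty}f(x)/g(x)=1$. Let $\mathbf{L}$ be the class of nonnegative measurable functions $g$ on $\mathbb{R}$ such that $g(x)>0$ for all sufficiently large $x$ and $g(x+a)\sim g(x)$ for every $a\in\mathbb{R}$. Define the following classes of probability distributions $\rho$ on $\mathbb{R}$. - For $\gamma\ge 0$: $\rho\in\mathcal{L}(\gamma)$ if $\bar\rho(x)>0$ for every $x\in\mathbb{R}$ and $\bar\rho(x+a)\sim e^{-\gamma a}\bar\rho(x)$ for every $a\in\mathbb{R}$. - For $\gamma\in\mathbb{R}$: $\rho\in\mathcal{M}(\gamma)$ if $\int_{-\infty}^{\infty}e^{\gamma x}\rho(dx)<\infty$. - For $\Delta=(0,c]$ with $c>0$: $\rho\in\mathcal{L}_\Delta$ if the function $x\mapsto\rho((x,x+c])$ belongs to $\mathbf{L}$; and $\rho\in\mathcal{S}_\Delta$ if $\rho\in\mathcal{L}_\Delta$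 and $\rho^{2*}((x,x+c])\sim 2\rho((x,x+c])$. - $\rho\in\mathcal{L}_{loc}$ (respectively $\rho\in\mathcal{S}_{loc}$) if $\rho\in\mathcal{L}_\Delta$ (respectively $\rho\in\mathcal{S}_\Delta$) for every $\Delta=(0,c]$ with $c>0$. A class $\mathcal{C}$ of probability distributions on $\mathbb{R}$ is closed under convolution roots if, for every probability distribution $\mu$ on $\mathbb{R}$, $\mu^{n*}\in\mathcal{C}$ for some integer $n\ge 1$ implies $\mu\in\mathcal{C}$. **Corollary 1.1.** Let $\Delta=(0,c]$ with $c>0$, and let $\gamma>0$. Then: (i) the class $\mathcal{S}_{loc}$ is not closed under convolution roots; (ii) the class $\mathcal{S}_\Delta$ is not closed under convolution roots; (iii) the class $\mathcal{L}(\gamma)\cap\mathcal{M}(\gamma)$ is not closed under convolution roots; (iv) the class $\mathcal{L}_{loc}$ is not closed under convolution roots; (v) the class $\mathcal{L}_\Delta$ is not closed under convolution roots. -/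

import Mathlib

open MeasureTheory Filter Topology Set

namespace ConvRoots

noncomputable section

/-- The relation `f ∼ g` as `x → ∞`: the ratio `f x / g x` tends to `1`.  (A ratio equal to `0` by
the convention for division by zero cannot tend to `1`, so both functions are nonzero for all
sufficiently large `x` whenever the relation holds.) -/
def AsympEq (f g : ℝ → ℝ) : Prop :=
  Tendsto (fun x => f x / g x) atTop (𝓝 1)

/-- The tail `x ↦ ρ((x, ∞))`. -/
def tail (ρ : ProbabilityMeasure ℝ) (x : ℝ) : ℝ :=
  (ρ : Measure ℝ).real (Ioi x)

/-- The local mass `x ↦ ρ((x, x + c])`. -/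
def localMass (ρ : ProbabilityMeasure ℝ) (c x : ℝ) : ℝ :=
  (ρ : Measure ℝ).real (Ioc x (x + c))

/-- The convolution `η ∗ ρ` of two probability distributions on the line. -/
def conv (η ρ : ProbabilityMeasure ℝ) : ProbabilityMeasure ℝ :=
  ⟨Measure.conv (η : Measure ℝ) (ρ : Measure ℝ), inferInstance⟩

/-- The `n`-th convolution power; the power `0` is the unit mass at `0`. -/
def convPow (ρ : ProbabilityMeasure ℝ) : ℕ → ProbabilityMeasure ℝ
  | 0 => ⟨Measure.dirac 0, inferInstance⟩
  | n + 1 => conv (convPow ρ n) ρ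

theorem convPow_one (ρ : ProbabilityMeasure ℝ) : convPow ρ 1 = ρ := by
  apply Subtype.ext
  exact Measure.dirac_zero_conv (ρ : Measure ℝ)

theorem convPow_two (ρ : ProbabilityMeasure ℝ) : convPow ρ 2 = conv ρ ρ := by
  change conv (convPow ρ 1) ρ = conv ρ ρ
  rw [convPow_one]

/-- The class `L(γ)` (used for `γ ≥ 0`). -/
def classL (γ : ℝ) : Set (ProbabilityMeasure ℝ) :=
  {ρ | (∀ x : ℝ, 0 < tail ρ x) ∧
    ∀ a : ℝ, AsympEq (fun x => tail ρ (x + a)) (fun x => Real.exp (-γ * a) * tail ρ x)}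

/-- The class `M(γ)` of distributions with finite `γ`-exponential moment. -/
def classM (γ : ℝ) : Set (ProbabilityMeasure ℝ) :=
  {ρ | Integrable (fun x : ℝ => Real.exp (γ * x)) (ρ : Measure ℝ)}

/-- The class of long-tailed functions: nonnegative measurable functions `g` on the line with
`g x > 0` for all sufficiently large `x` and `g (x + a) ∼ g x` for every real `a`. -/
def LongTailedFun : Set (ℝ → ℝ) :=
  {g | Measurable g ∧ (∀ x, 0 ≤ g x) ∧ (∀ᶠ x in atTop, 0 < g x) ∧
    ∀ a : ℝ, AsympEq (fun x => g (x + a)) g}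

/-- The class `L_Δ` for `Δ = (0, c]`. -/
def classLDelta (c : ℝ) : Set (ProbabilityMeasure ℝ) :=
  {ρ | localMass ρ c ∈ LongTailedFun}

/-- The class `S_Δ` for `Δ = (0, c]`. -/
def classSDelta (c : ℝ) : Set (ProbabilityMeasure ℝ) :=
  {ρ | ρ ∈ classLDelta c ∧ AsympEq (localMass (convPow ρ 2) c) (fun x => 2 * localMass ρ c x)}

/-- The class `L_loc`. -/
def classLLoc : Set (ProbabilityMeasure ℝ) :=
  {ρ | ∀ c : ℝ, 0 < c → ρ ∈ classLDelta c}

/-- The class `S_loc` of locally subexponential distributions. -/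
def classSLoc : Set (ProbabilityMeasure ℝ) :=
  {ρ | ∀ c : ℝ, 0 < c → ρ ∈ classSDelta c}

/-- A class `C` of distributions is closed under convolution roots if a distribution belongs to `C`
as soon as one of its convolution powers of positive order does. -/
def ClosedUnderConvRoots (C : Set (ProbabilityMeasure ℝ)) : Prop :=
  ∀ μ : ProbabilityMeasure ℝ, (∃ n : ℕ, 1 ≤ n ∧ convPow μ n ∈ C) → μ ∈ C

end

end ConvRoots

namespace ConvRoots

/-! A square root of a good distribution can be bad when its oscillation is averaged out by
convolution. Put `ω = π / c` and take a density `f` with `f x = K (1 + cos (ω x)) / x ^ 2` for `x >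
1` and with vanishing Fourier coefficient at `ω` (`exists_density`). In `f * f` one factor has a
large argument, so `x ^ 2 (f * f) x` is asymptotic to `2 (f * H) x` with `H x = K (1 + cos (ω x))`
(`tendsto_sq_mul_selfConv`). The vanishing coefficient makes `f * H` equal to `K`. Hence `f * f`
behaves like `2 K / x ^ 2`, which gives local subexponentiality (`dist_mem_classSLoc`).

The oscillation survives in the masses of `f` on `(x, x + c]`: the window is half a period, and its
indicator has nonzero sine coefficient at `ω` (`dist_notMem_classLDelta`). This settles the four
local classes.

For `L(γ) ∩ M(γ)`, replace `f` by its tilt, proportional to `e ^ (-γ x) f x`. Tilting commutes with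
convolution (`selfConv_tilt`), and a tilted tail is `e ^ (-γ x)` times an average of `f` with
exponential weight, whose cosine coefficient is nonzero. Both negative results rest on
`fourier_eq_zero_of_tendsto_div`. -/

/-! ### Bounded densities: convolution, local masses and tails. -/

/-- A bounded probability density on the line. -/
structure IsBddDensity (f : ℝ → ℝ) : Prop where
  measurable : Measurable f
  nonneg : ∀ x, 0 ≤ f x
  integrable : Integrable f
  integral_eq_one : ∫ x, f x = 1
  bdd : ∃ B, ∀ x, f x ≤ B

/-- The convolution of a function with itself. -/
noncomputable def selfConv (f : ℝ → ℝ) (x : ℝ) : ℝ := ∫ y, f y * f (x - y)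

namespace IsBddDensity

variable {f : ℝ → ℝ}

/-- The probability distribution with density `f`. -/
noncomputable def dist (hf : IsBddDensity f) : ProbabilityMeasure ℝ :=
  ⟨volume.withDensity fun x => ENNReal.ofReal (f x), by
    constructor
    rw [withDensity_apply _ MeasurableSet.univ, Measure.restrict_univ,
      ← ofReal_integral_eq_lintegral_ofReal hf.integrable (ae_of_all _ hf.nonneg),
      hf.integral_eq_one, ENNReal.ofReal_one]⟩

theorem coe_dist (hf : IsBddDensity f) :
    (hf.dist : Measure ℝ) = volume.withDensity fun x => ENNReal.ofReal (f x) := rfl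

theorem real_dist (hf : IsBddDensity f) {s : Set ℝ} (hs : MeasurableSet s) :
    (hf.dist : Measure ℝ).real s = ∫ x in s, f x := by
  rw [coe_dist, Measure.real, withDensity_apply _ hs,
    ← ofReal_integral_eq_lintegral_ofReal hf.integrable.integrableOn (ae_of_all _ hf.nonneg),
    ENNReal.toReal_ofReal (integral_nonneg hf.nonneg)]

theorem integrable_mul_comp (hf : IsBddDensity f) {w u : ℝ → ℝ} (hw : Integrable w)
    (hu : Measurable u) : Integrable fun s => w s * f (u s) := by
  obtain ⟨B, hB⟩ := hf.bdd
  refine hw.mul_bdd (c := B) (hf.measurable.comp hu).aestronglyMeasurable (ae_of_all _ fun s => ?_)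
  rw [Real.norm_eq_abs, abs_of_nonneg (hf.nonneg _)]
  exact hB _

theorem integrable_selfConv_integrand (hf : IsBddDensity f) (x : ℝ) :
    Integrable fun y => f y * f (x - y) :=
  hf.integrable_mul_comp hf.integrable (measurable_const.sub measurable_id)

theorem selfConv (hf : IsBddDensity f) : IsBddDensity (selfConv f) := by
  have e : ConvRoots.selfConv f = convolution f f (ContinuousLinearMap.mul ℝ ℝ) volume := rfl
  refine ⟨?_, fun x => integral_nonneg fun y => mul_nonneg (hf.nonneg _) (hf.nonneg _), ?_, ?_, ?_⟩
  · have : StronglyMeasurable fun q : ℝ × ℝ => f q.2 * f (q.1 - q.2) :=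
      ((hf.measurable.comp measurable_snd).mul
        (hf.measurable.comp (measurable_fst.sub measurable_snd))).stronglyMeasurable
    exact this.integral_prod_right.measurable
  · rw [e]
    exact hf.integrable.integrable_convolution _ hf.integrable
  · rw [e, integral_convolution _ hf.integrable hf.integrable]
    simp [hf.integral_eq_one]
  · obtain ⟨B, hB⟩ := hf.bdd
    refine ⟨B, fun x => ?_⟩
    calc ConvRoots.selfConv f x ≤ ∫ y, f y * B :=
          integral_mono (hf.integrable_selfConv_integrand x) (hf.integrable.mul_const B)
            fun y => mul_le_mul_of_nonneg_left (hB _) (hf.nonneg _)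
      _ = B := by rw [integral_mul_const, hf.integral_eq_one, one_mul]

theorem conv_dist (hf : IsBddDensity f) : conv hf.dist hf.dist = hf.selfConv.dist := by
  apply Subtype.ext
  change Measure.conv (volume.withDensity _) (volume.withDensity _) = volume.withDensity _
  rw [conv_withDensity_eq_lconvolution hf.measurable.ennreal_ofReal hf.measurable.ennreal_ofReal]
  congr 1
  ext x
  rw [lconvolution_def, ConvRoots.selfConv, ofReal_integral_eq_lintegral_ofReal
    (hf.integrable_selfConv_integrand x)
    (ae_of_all _ fun y => mul_nonneg (hf.nonneg _) (hf.nonneg _))]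
  refine lintegral_congr fun y => ?_
  rw [ENNReal.ofReal_mul (hf.nonneg _), neg_add_eq_sub]

theorem convPow_two_dist (hf : IsBddDensity f) : convPow hf.dist 2 = hf.selfConv.dist := by
  rw [convPow_two, conv_dist]

theorem setIntegral_translate (f : ℝ → ℝ) {s : Set ℝ} (hs : MeasurableSet s) (x : ℝ) :
    ∫ y in (fun y => y - x) ⁻¹' s, f y = ∫ y in s, f (x + y) := by
  have hm : MeasurableSet ((fun y : ℝ => y - x) ⁻¹' s) := hs.preimage (measurable_id.sub_const x)
  rw [← integral_indicator hs, ← integral_indicator hm, ← integral_add_left_eq_self _ x]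
  refine integral_congr_ae (ae_of_all _ fun y => ?_)
  have : x + y ∈ (fun y => y - x) ⁻¹' s ↔ y ∈ s := by rw [mem_preimage, add_sub_cancel_left]
  by_cases hy : y ∈ s
  · exact (indicator_of_mem (this.2 hy) f).trans (indicator_of_mem hy fun y => f (x + y)).symm
  · exact (indicator_of_notMem (mt this.1 hy) f).trans (indicator_of_notMem hy fun y => f (x + y)).symm

theorem localMass_dist (hf : IsBddDensity f) (c x : ℝ) :
    localMass hf.dist c x = ∫ s, (Ioc 0 c).indicator (fun _ => 1) s * f (x + s) := by
  rw [localMass, hf.real_dist measurableSet_Ioc]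
  have : Ioc x (x + c) = (fun y => y - x) ⁻¹' Ioc 0 c := by
    ext y; simp [add_comm]
  rw [this, setIntegral_translate f measurableSet_Ioc, ← integral_indicator measurableSet_Ioc]
  congr 1; ext s; simp [indicator]

theorem tail_dist (hf : IsBddDensity f) (x : ℝ) :
    tail hf.dist x = ∫ s in Ioi 0, f (x + s) := by
  rw [tail, hf.real_dist measurableSet_Ioi]
  have : Ioi x = (fun y => y - x) ⁻¹' Ioi 0 := by
    ext y; simp
  rw [this, setIntegral_translate f measurableSet_Ioi]

theorem measurable_localMass (hf : IsBddDensity f) (c : ℝ) : Measurable (localMass hf.dist c) := by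
  have : localMass hf.dist c = fun x => ∫ s, (Ioc 0 c).indicator (fun _ => 1) s * f (x + s) :=
    funext (hf.localMass_dist c)
  rw [this]
  have : StronglyMeasurable fun q : ℝ × ℝ =>
      (Ioc 0 c).indicator (fun _ => (1 : ℝ)) q.2 * f (q.1 + q.2) :=
    (((measurable_const.indicator measurableSet_Ioc).comp measurable_snd).mul
        (hf.measurable.comp (measurable_fst.add measurable_snd))).stronglyMeasurable
  exact this.integral_prod_right.measurable

end IsBddDensity


/-! ### Averages of quadratically decaying functions. -/

theorem tendsto_sq_div_add_sq (s : ℝ) :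
    Tendsto (fun x : ℝ => x ^ 2 / (x + s) ^ 2) atTop (𝓝 1) := by
  have h : Tendsto (fun x : ℝ => 1 - s / (x + s)) atTop (𝓝 (1 - 0)) :=
    tendsto_const_nhds.sub ((tendsto_atTop_add_const_right _ s tendsto_id).const_div_atTop s)
  have h2 := h.pow 2
  simp only [sub_zero, one_pow] at h2
  refine h2.congr' ?_
  filter_upwards [eventually_gt_atTop (-s)] with x hx
  have : x + s ≠ 0 := by linarith
  field_simp
  ring

theorem tendsto_sq_mul_translate {g H : ℝ → ℝ} {B : ℝ} (hB : ∀ x, |H x| ≤ B)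
    (h : Tendsto (fun x => x ^ 2 * g x - H x) atTop (𝓝 0)) (s : ℝ) :
    Tendsto (fun x => x ^ 2 * g (x + s) - H (x + s)) atTop (𝓝 0) := by
  have hs := tendsto_atTop_add_const_right atTop s (tendsto_id (α := ℝ))
  have h1 := h.comp hs
  have h2 := tendsto_sq_div_add_sq s
  have h3 : Tendsto (fun x : ℝ => (x ^ 2 / (x + s) ^ 2 - 1) * H (x + s)) atTop (𝓝 0) := by
    have h4 : Tendsto (fun x : ℝ => (x ^ 2 / (x + s) ^ 2 - 1)) atTop (𝓝 0) := by
      simpa using h2.sub_const 1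
    refine h4.zero_mul_isBoundedUnder_le ?_
    exact isBoundedUnder_of ⟨B, fun x => hB _⟩
  have h5 := (h2.mul h1).add h3
  simp only [mul_zero, add_zero] at h5
  refine h5.congr' ?_
  filter_upwards [eventually_gt_atTop (-s)] with x hx
  have : x + s ≠ 0 := by linarith
  simp only [Function.comp, id]
  field_simp
  ring

/-- Dominated convergence. The cutoff `s > -x / 2` keeps `x + s` above `x / 2`, where `g` is already
controlled by its asymptotics; it is needed for weights charging the negative half-line, such as the
reflected density in `tendsto_sq_mul_selfConv`. -/
theorem tendsto_integral_mul_truncated {g H w : ℝ → ℝ} {B : ℝ} (hg : Measurable g)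
    (hH : Measurable H) (hw : Integrable w) (hB : ∀ x, |H x| ≤ B)
    (h : Tendsto (fun x => x ^ 2 * g x - H x) atTop (𝓝 0)) :
    Tendsto (fun x => ∫ s, w s *
      ((Ioi (-x / 2)).indicator (fun s => x ^ 2 * g (x + s)) s - H (x + s))) atTop (𝓝 0) := by
  have key : Tendsto (fun x => ∫ s, w s *
      ((Ioi (-x / 2)).indicator (fun s => x ^ 2 * g (x + s)) s - H (x + s))) atTop
      (𝓝 (∫ s : ℝ, (fun _ => (0 : ℝ)) s)) := by
    obtain ⟨x₀, hx₀⟩ := eventually_atTop.1 (h.eventually (Metric.ball_mem_nhds 0 one_pos))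
    have hb : ∀ y, x₀ ≤ y → y ^ 2 * |g y| ≤ B + 1 := fun y hy => by
      have h1 := hx₀ y hy
      rw [dist_zero_right, Real.norm_eq_abs] at h1
      have h2 := hB y
      have h3 := abs_add_le (y ^ 2 * g y - H y) (H y)
      rw [sub_add_cancel, abs_mul, abs_of_nonneg (sq_nonneg y)] at h3
      linarith
    refine tendsto_integral_filter_of_dominated_convergence
      -- On the cutoff region `x ^ 2 ≤ 4 (x + s) ^ 2`, which turns the bound `B + 1` on `y ^ 2 |g
      -- y|` into `4 (B + 1)`.
      (fun s => |w s| * (4 * (B + 1) + B)) (Eventually.of_forall fun x => ?_) ?_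
      (hw.abs.mul_const _) (ae_of_all _ fun s => ?_)
    · refine hw.aestronglyMeasurable.mul (Measurable.aestronglyMeasurable ?_)
      exact (((hg.comp (measurable_const_add x)).const_mul _).indicator measurableSet_Ioi).sub
        (hH.comp (measurable_const_add x))
    · filter_upwards [eventually_ge_atTop (2 * x₀), eventually_ge_atTop 0] with x hx hx0
      refine ae_of_all _ fun s => ?_
      rw [Real.norm_eq_abs, abs_mul]
      refine mul_le_mul_of_nonneg_left ((abs_sub _ _).trans (add_le_add ?_ (hB _))) (abs_nonneg _)
      by_cases hs : s ∈ Ioi (-x / 2)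
      · rw [indicator_of_mem hs, abs_mul, abs_of_nonneg (sq_nonneg x)]
        rw [mem_Ioi] at hs
        have h1 := hb (x + s) (by linarith)
        have h2 : x ^ 2 ≤ 4 * (x + s) ^ 2 := by nlinarith
        nlinarith [abs_nonneg (g (x + s))]
      · rw [indicator_of_notMem hs, abs_zero]
        have := (abs_nonneg _).trans (hB 0)
        positivity
    · rw [← mul_zero (w s)]
      refine ((tendsto_sq_mul_translate hB h s).congr' ?_).const_mul (w s)
      filter_upwards [eventually_gt_atTop (-2 * s)] with x hx
      rw [indicator_of_mem (by rw [mem_Ioi]; linarith)]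
  simpa using key

theorem integrable_mul_comp_of_bounded {w H u : ℝ → ℝ} {B : ℝ} (hw : Integrable w)
    (hH : Measurable H) (hB : ∀ x, |H x| ≤ B) (hu : Measurable u) :
    Integrable fun s => w s * H (u s) :=
  hw.mul_bdd (c := B) (hH.comp hu).aestronglyMeasurable (ae_of_all _ fun _ => hB _)

namespace IsBddDensity

variable {f : ℝ → ℝ}

/-- Averaging an asymptotic relation against a weight supported on the positive half-line. -/
theorem tendsto_sq_mul_integral (hf : IsBddDensity f) {H w : ℝ → ℝ} {B : ℝ}
    (hH : Measurable H) (hw : Integrable w) (hw0 : ∀ s ≤ 0, w s = 0) (hB : ∀ x, |H x| ≤ B)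
    (h : Tendsto (fun x => x ^ 2 * f x - H x) atTop (𝓝 0)) :
    Tendsto (fun x => x ^ 2 * (∫ s, w s * f (x + s)) - ∫ s, w s * H (x + s)) atTop (𝓝 0) := by
  refine (tendsto_integral_mul_truncated hf.measurable hH hw hB h).congr' ?_
  filter_upwards [eventually_gt_atTop 0] with x hx
  rw [← integral_const_mul, ← integral_sub
    ((hf.integrable_mul_comp hw (measurable_const_add x)).const_mul _)
    (integrable_mul_comp_of_bounded hw hH hB (measurable_const_add x))]
  refine integral_congr_ae (ae_of_all _ fun s => ?_)
  by_cases hs : s ≤ 0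
  · simp [hw0 s hs]
  · have : s ∈ Ioi (-x / 2) := by rw [mem_Ioi]; linarith
    simp only [indicator_of_mem this]
    ring

/-- The reflection `y ↦ x - y` swaps the two halves. In the half kept, the second factor is
evaluated beyond `x / 2`. -/
theorem selfConv_eq_two_mul (hf : IsBddDensity f) (x : ℝ) :
    ConvRoots.selfConv f x = 2 * ∫ y in Iio (x / 2), f y * f (x - y) := by
  have hi := hf.integrable_selfConv_integrand x
  have e : ∫ y in Ici (x / 2), f y * f (x - y) = ∫ y in Iio (x / 2), f y * f (x - y) := by
    rw [integral_Ici_eq_integral_Ioi, ← integral_indicator measurableSet_Ioi,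
      ← integral_indicator measurableSet_Iio,
      ← integral_sub_left_eq_self _ volume x]
    refine integral_congr_ae (ae_of_all _ fun y => ?_)
    have : x - y ∈ Ioi (x / 2) ↔ y ∈ Iio (x / 2) := by
      rw [mem_Ioi, mem_Iio]; constructor <;> intro h <;> linarith
    simp only [indicator, this, sub_sub_cancel, mul_comm]
  rw [ConvRoots.selfConv, ← integral_add_compl measurableSet_Iio hi, compl_Iio, e, two_mul]

/-- Convolution averages a bounded modulation `H` of a quadratically decaying tail. -/
theorem tendsto_sq_mul_selfConv (hf : IsBddDensity f) {H : ℝ → ℝ} {A B : ℝ}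
    (hH : Measurable H) (hB : ∀ x, |H x| ≤ B) (hA : ∀ x, ∫ y, f y * H (x - y) = A)
    (h : Tendsto (fun x => x ^ 2 * f x - H x) atTop (𝓝 0)) :
    Tendsto (fun x => x ^ 2 * ConvRoots.selfConv f x) atTop (𝓝 (2 * A)) := by
  -- With the weight `f (-s)` and `y = -s`, the cutoff is exactly `y < x / 2`.
  have key := tendsto_integral_mul_truncated hf.measurable hH hf.integrable.comp_neg hB h
  have h2 := (key.add_const A).const_mul 2
  rw [zero_add] at h2
  refine h2.congr fun x => ?_
  rw [hf.selfConv_eq_two_mul, ← integral_indicator measurableSet_Iio,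
    ← integral_neg_eq_self (fun s => f (-s) * _)]
  have e : ∀ y, f (-(-y)) * ((Ioi (-x / 2)).indicator (fun s => x ^ 2 * f (x + s)) (-y)
      - H (x + -y)) = x ^ 2 * (Iio (x / 2)).indicator (fun y => f y * f (x - y)) y
        - f y * H (x - y) := fun y => by
    have : -y ∈ Ioi (-x / 2) ↔ y ∈ Iio (x / 2) := by
      rw [mem_Ioi, mem_Iio]; constructor <;> intro h <;> linarith
    simp only [indicator, this, neg_neg, ← sub_eq_add_neg]
    split_ifs <;> ring
  simp_rw [e]
  rw [integral_sub (((hf.integrable_selfConv_integrand x).indicator measurableSet_Iio).const_mul _)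
    (integrable_mul_comp_of_bounded (u := fun y => x - y) hf.integrable hH hB
      (measurable_const.sub measurable_id)),
    integral_const_mul, hA]
  ring

end IsBddDensity


/-! ### Construction of the oscillating density. -/

theorem integral_trig_period (C a b : ℝ) :
    ∫ u in -(2 * Real.pi)..0, (C + a * Real.cos u + b * Real.sin u) = 2 * Real.pi * C := by
  rw [intervalIntegral.integral_eq_sub_of_hasDerivAt
    (f := fun u => C * u + a * Real.sin u - b * Real.cos u)
    (fun u _ => ?_) (Continuous.intervalIntegrable (by fun_prop) _ _)]
  · simp; ring
  · convert! (((hasDerivAt_id u).const_mul C).add ((Real.hasDerivAt_sin u).const_mul a)).sub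
      ((Real.hasDerivAt_cos u).const_mul b) using 1
    ring

theorem integral_trig_mul_cos_period (C a b : ℝ) :
    ∫ u in -(2 * Real.pi)..0, (C + a * Real.cos u + b * Real.sin u) * Real.cos u
      = a * Real.pi := by
  rw [intervalIntegral.integral_eq_sub_of_hasDerivAt
    (f := fun u => C * Real.sin u + a / 2 * (u + Real.sin u * Real.cos u)
      + b / 2 * (Real.sin u * Real.sin u))
    (fun u _ => ?_) (Continuous.intervalIntegrable (by fun_prop) _ _)]
  · simp; ring
  · convert! (((Real.hasDerivAt_sin u).const_mul C).add (((hasDerivAt_id u).add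
      ((Real.hasDerivAt_sin u).mul (Real.hasDerivAt_cos u))).const_mul (a / 2))).add
      (((Real.hasDerivAt_sin u).mul (Real.hasDerivAt_sin u)).const_mul (b / 2)) using 1
    linear_combination (a / 2) * Real.sin_sq_add_cos_sq u

theorem integral_trig_mul_sin_period (C a b : ℝ) :
    ∫ u in -(2 * Real.pi)..0, (C + a * Real.cos u + b * Real.sin u) * Real.sin u
      = b * Real.pi := by
  rw [intervalIntegral.integral_eq_sub_of_hasDerivAt
    (f := fun u => -C * Real.cos u + a / 2 * (Real.sin u * Real.sin u)
      + b / 2 * (u - Real.sin u * Real.cos u))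
    (fun u _ => ?_) (Continuous.intervalIntegrable (by fun_prop) _ _)]
  · simp; ring
  · convert! (((Real.hasDerivAt_cos u).const_mul (-C)).add
      (((Real.hasDerivAt_sin u).mul (Real.hasDerivAt_sin u)).const_mul (a / 2))).add
      (((hasDerivAt_id u).sub
      ((Real.hasDerivAt_sin u).mul (Real.hasDerivAt_cos u))).const_mul (b / 2)) using 1
    linear_combination (b / 2) * Real.sin_sq_add_cos_sq u

/-- The modulated tail `(1 + cos (ω x)) / x ^ 2` on `(1, ∞)`. -/
noncomputable def modTail (ω : ℝ) : ℝ → ℝ :=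
  (Ioi 1).indicator fun x => (1 + Real.cos (ω * x)) / x ^ 2

/-- A trigonometric polynomial restricted to one period. -/
noncomputable def bump (ω a b : ℝ) : ℝ → ℝ :=
  (Ioc (-(2 * Real.pi / ω)) 0).indicator fun x =>
    1 + |a| + |b| + a * Real.cos (ω * x) + b * Real.sin (ω * x)

theorem modTail_nonneg (ω x : ℝ) : 0 ≤ modTail ω x :=
  indicator_nonneg (fun x _ => div_nonneg (by linarith [Real.neg_one_le_cos (ω * x)])
    (sq_nonneg x)) x

theorem modTail_le (ω x : ℝ) : modTail ω x ≤ 2 := by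
  refine indicator_apply_le' (fun hx => ?_) fun _ => zero_le_two
  rw [mem_Ioi] at hx
  rw [div_le_iff₀ (by positivity)]
  nlinarith [Real.cos_le_one (ω * x)]

theorem measurable_modTail (ω : ℝ) : Measurable (modTail ω) :=
  Measurable.indicator (by fun_prop) measurableSet_Ioi

theorem integrable_modTail (ω : ℝ) : Integrable (modTail ω) := by
  rw [modTail, integrable_indicator_iff measurableSet_Ioi]
  have h := (integrableOn_Ioi_rpow_of_lt (a := -2) (by norm_num) one_pos).const_mul 2
  refine h.mono' (Measurable.aestronglyMeasurable (by fun_prop)) ?_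
  refine (ae_restrict_mem measurableSet_Ioi).mono fun x hx => ?_
  have hx0 : (0 : ℝ) < x := one_pos.trans hx
  rw [Real.rpow_neg hx0.le, Real.rpow_two, Real.norm_eq_abs, abs_of_nonneg
    (div_nonneg (by linarith [Real.neg_one_le_cos (ω * x)]) (sq_nonneg x)), div_eq_mul_inv]
  exact mul_le_mul_of_nonneg_right (by linarith [Real.cos_le_one (ω * x)]) (by positivity)

theorem abs_trig_le (a b u : ℝ) : |a * Real.cos u + b * Real.sin u| ≤ |a| + |b| := by
  refine (abs_add_le _ _).trans (add_le_add ?_ ?_) <;> rw [abs_mul]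
  · exact mul_le_of_le_one_right (abs_nonneg _) (Real.abs_cos_le_one u)
  · exact mul_le_of_le_one_right (abs_nonneg _) (Real.abs_sin_le_one u)

theorem bump_nonneg (ω a b x : ℝ) : 0 ≤ bump ω a b x :=
  indicator_nonneg (fun x _ => by linarith [(abs_le.1 (abs_trig_le a b (ω * x))).1]) x

theorem bump_le (ω a b x : ℝ) : bump ω a b x ≤ 1 + 2 * (|a| + |b|) :=
  indicator_apply_le' (fun _ => by linarith [(abs_le.1 (abs_trig_le a b (ω * x))).2])
    fun _ => by positivity

theorem measurable_bump (ω a b : ℝ) : Measurable (bump ω a b) :=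
  Measurable.indicator (by fun_prop) measurableSet_Ioc

theorem integrable_bump (ω a b : ℝ) : Integrable (bump ω a b) := by
  rw [bump, integrable_indicator_iff measurableSet_Ioc]
  exact (Continuous.continuousOn (by fun_prop)).integrableOn_Icc.mono_set Ioc_subset_Icc_self

/-- The substitution `u = ω x` gives an integral over one full period, where orthogonality isolates
the coefficients `a` and `b`. -/
theorem integral_bump_mul {ω : ℝ} (hω : 0 < ω) (a b : ℝ) (h : ℝ → ℝ) :
    ∫ x, bump ω a b x * h (ω * x) = ω⁻¹ * ∫ u in -(2 * Real.pi)..0,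
      (1 + |a| + |b| + a * Real.cos u + b * Real.sin u) * h u := by
  have e := intervalIntegral.integral_comp_mul_left (a := -(2 * Real.pi / ω)) (b := 0)
    (fun u => (1 + |a| + |b| + a * Real.cos u + b * Real.sin u) * h u) hω.ne'
  rw [mul_zero, mul_neg, mul_div_cancel₀ _ hω.ne', smul_eq_mul, intervalIntegral.integral_of_le
    (by have := Real.pi_pos; have : 0 < 2 * Real.pi / ω := by positivity
        linarith), ← integral_indicator measurableSet_Ioc] at e
  rw [← e]
  refine integral_congr_ae (ae_of_all _ fun x => ?_)
  simp only [bump, indicator]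
  split_ifs <;> simp

/-- A bounded density with an oscillating quadratic tail of frequency `ω`, and whose Fourier
coefficient at the same frequency vanishes. -/
theorem exists_density {ω : ℝ} (hω : 0 < ω) :
    ∃ (f : ℝ → ℝ) (K L : ℝ), IsBddDensity f ∧ 0 < K ∧ (∀ x ≤ L, f x = 0) ∧
      (∀ x > 1, x ^ 2 * f x = K * (1 + Real.cos (ω * x))) ∧
      ∫ x, f x * Real.cos (ω * x) = 0 ∧ ∫ x, f x * Real.sin (ω * x) = 0 := by
  -- The bump contributes `a π / ω` and `b π / ω` to the cosine and sine coefficients, so these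
  -- values cancel the contribution of the tail.
  set a := -(ω / Real.pi * ∫ x, modTail ω x * Real.cos (ω * x)) with ha
  set b := -(ω / Real.pi * ∫ x, modTail ω x * Real.sin (ω * x)) with hb
  have hπ := Real.pi_pos
  set g := fun x => modTail ω x + bump ω a b x with hg
  have hgi : Integrable g := (integrable_modTail ω).add (integrable_bump ω a b)
  set N := ∫ x, g x with hN
  have hN0 : 0 < N := by
    have h1 := integral_bump_mul hω a b fun _ => 1
    simp only [mul_one, integral_trig_period] at h1
    rw [hN, hg, integral_add (integrable_modTail ω) (integrable_bump ω a b), h1]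
    have h2 : 0 ≤ ∫ x, modTail ω x := integral_nonneg (modTail_nonneg ω)
    positivity
  have hcos : ∀ {u : ℝ → ℝ}, Integrable u → Integrable fun x => u x * Real.cos (ω * x) :=
    fun hu => integrable_mul_comp_of_bounded hu Real.measurable_cos Real.abs_cos_le_one
      (measurable_const_mul ω)
  have hsin : ∀ {u : ℝ → ℝ}, Integrable u → Integrable fun x => u x * Real.sin (ω * x) :=
    fun hu => integrable_mul_comp_of_bounded hu Real.measurable_sin Real.abs_sin_le_one
      (measurable_const_mul ω)
  refine ⟨fun x => g x / N, 1 / N, -(2 * Real.pi / ω), ⟨?_, fun x => ?_, hgi.div_const N, ?_, ?_⟩,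
    by positivity, fun x hx => ?_, fun x hx => ?_, ?_, ?_⟩
  · exact ((measurable_modTail ω).add (measurable_bump ω a b)).div_const N
  · exact div_nonneg (add_nonneg (modTail_nonneg ω x) (bump_nonneg ω a b x)) hN0.le
  · rw [integral_div, ← hN, div_self hN0.ne']
  · exact ⟨(2 + (1 + 2 * (|a| + |b|))) / N, fun x => div_le_div_of_nonneg_right
      (add_le_add (modTail_le ω x) (bump_le ω a b x)) hN0.le⟩
  · have h0 : 0 < 2 * Real.pi / ω := by positivity
    have h1 : x ∉ Ioi (1 : ℝ) := by rw [mem_Ioi]; linarith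
    have h2 : x ∉ Ioc (-(2 * Real.pi / ω)) 0 := fun h => absurd h.1 (not_lt.2 hx)
    simp [hg, modTail, bump, indicator_of_notMem h1, indicator_of_notMem h2]
  · have h1 : x ∈ Ioi (1 : ℝ) := hx
    have h2 : x ∉ Ioc (-(2 * Real.pi / ω)) 0 := fun h => by
      have : (1 : ℝ) < x := hx
      linarith [h.2]
    have h3 : x ≠ 0 := by
      have : (1 : ℝ) < x := hx
      linarith
    simp only [hg, modTail, bump, indicator_of_mem h1, indicator_of_notMem h2]
    field_simp
    ring
  · simp only [div_mul_eq_mul_div]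
    rw [integral_div, div_eq_zero_iff]
    left
    simp only [hg, add_mul]
    rw [integral_add (hcos (integrable_modTail ω)) (hcos (integrable_bump ω a b)),
      integral_bump_mul hω a b Real.cos, integral_trig_mul_cos_period, ha]
    field_simp
    ring
  · simp only [div_mul_eq_mul_div]
    rw [integral_div, div_eq_zero_iff]
    left
    simp only [hg, add_mul]
    rw [integral_add (hsin (integrable_modTail ω)) (hsin (integrable_bump ω a b)),
      integral_bump_mul hω a b Real.sin, integral_trig_mul_sin_period, hb]
    field_simp
    ring


/-! ### Comparison of ratios and local subexponentiality. -/

theorem integral_linear_combination {u v w : ℝ → ℝ} (hu : Integrable u) (hv : Integrable v)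
    (hw : Integrable w) (a b c : ℝ) :
    ∫ x, (a * u x + b * v x + c * w x)
      = a * (∫ x, u x) + b * (∫ x, v x) + c * ∫ x, w x := by
  have h : Integrable fun x => a * u x + b * v x := (hu.const_mul a).add (hv.const_mul b)
  rw [integral_add h (hw.const_mul c), integral_add (hu.const_mul a) (hv.const_mul b),
    integral_const_mul, integral_const_mul, integral_const_mul]

theorem tendsto_div_of_tendsto_sq_mul {u v : ℝ → ℝ} {A B : ℝ} (hB : B ≠ 0)
    (hu : Tendsto (fun x => x ^ 2 * u x) atTop (𝓝 A))
    (hv : Tendsto (fun x => x ^ 2 * v x) atTop (𝓝 B)) :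
    Tendsto (fun x => u x / v x) atTop (𝓝 (A / B)) := by
  refine (hu.div hv hB).congr' ?_
  filter_upwards [eventually_gt_atTop 0] with x hx
  exact mul_div_mul_left _ _ (by positivity)

theorem tendsto_sq_mul_translate_of_tendsto {v : ℝ → ℝ} {A : ℝ}
    (h : Tendsto (fun x => x ^ 2 * v x) atTop (𝓝 A)) (a : ℝ) :
    Tendsto (fun x => x ^ 2 * v (x + a)) atTop (𝓝 A) := by
  have h1 := tendsto_sq_mul_translate (g := v) (H := fun _ => A) (fun _ => le_rfl)
    (by simpa using h.sub_const A) a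
  simpa using h1.add_const A

theorem eventually_pos_of_tendsto_sq_mul {v : ℝ → ℝ} {A : ℝ} (hA : 0 < A)
    (h : Tendsto (fun x => x ^ 2 * v x) atTop (𝓝 A)) : ∀ᶠ x in atTop, 0 < v x := by
  filter_upwards [h.eventually (lt_mem_nhds hA)] with x hx
  exact pos_of_mul_pos_right hx (sq_nonneg x)

/-- If `x ^ 2 * v x` is asymptotic to a periodic function, and `v (x + a) ∼ v x`, then `a` is a
period of that function. -/
theorem add_eq_of_tendsto_div {v W : ℝ → ℝ} {p a B : ℝ} (hp : 0 < p)
    (hW : Function.Periodic W p) (hB : ∀ x, |W x| ≤ B)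
    (h : Tendsto (fun x => x ^ 2 * v x - W x) atTop (𝓝 0))
    (hr : Tendsto (fun x => v (x + a) / v x) atTop (𝓝 1)) (x : ℝ) : W (x + a) = W x := by
  -- Along this sequence `W` is constant, so the asymptotics become genuine limits.
  have hy : Tendsto (fun n : ℕ => x + n * p) atTop atTop :=
    tendsto_atTop_add_const_left _ x (tendsto_natCast_atTop_atTop.atTop_mul_const hp)
  have e1 : ∀ n : ℕ, W (x + n * p) = W x := fun n => hW.nat_mul n x
  have e2 : ∀ n : ℕ, W (x + n * p + a) = W (x + a) := fun n => by
    rw [add_right_comm]; exact hW.nat_mul n (x + a)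
  have h1 : Tendsto (fun n : ℕ => (x + n * p) ^ 2 * v (x + n * p)) atTop (𝓝 (W x)) := by
    simpa [Function.comp_def, e1] using (h.comp hy).add_const (W x)
  have h2 : Tendsto (fun n : ℕ => (x + n * p) ^ 2 * v (x + n * p + a)) atTop (𝓝 (W (x + a))) := by
    simpa [Function.comp_def, e2] using
      ((tendsto_sq_mul_translate hB h a).comp hy).add_const (W (x + a))
  have h3 := (hr.comp hy).mul h1
  rw [one_mul] at h3
  refine tendsto_nhds_unique h2 (h3.congr' ?_)
  filter_upwards [(hr.comp hy).eventually_ne one_ne_zero] with n hn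
  have : v (x + n * p) ≠ 0 := fun h0 => hn (by simp [h0])
  simp only [Function.comp]
  field_simp

namespace IsBddDensity

variable {f : ℝ → ℝ}

theorem tendsto_sq_mul_integral_of_tendsto (hf : IsBddDensity f) {w : ℝ → ℝ} {K : ℝ}
    (hw : Integrable w) (hw0 : ∀ s ≤ 0, w s = 0)
    (h : Tendsto (fun x => x ^ 2 * f x) atTop (𝓝 K)) :
    Tendsto (fun x => x ^ 2 * ∫ s, w s * f (x + s)) atTop (𝓝 ((∫ s, w s) * K)) := by
  have h1 := hf.tendsto_sq_mul_integral (H := fun _ => K) measurable_const hw hw0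
    (fun _ => le_rfl) (by simpa using h.sub_const K)
  simp only [integral_mul_const] at h1
  simpa using h1.add_const ((∫ s, w s) * K)

theorem tendsto_sq_mul_selfConv_of_tendsto (hf : IsBddDensity f) {K : ℝ}
    (h : Tendsto (fun x => x ^ 2 * f x) atTop (𝓝 K)) :
    Tendsto (fun x => x ^ 2 * ConvRoots.selfConv f x) atTop (𝓝 (2 * K)) :=
  hf.tendsto_sq_mul_selfConv (H := fun _ => K) measurable_const (fun _ => le_rfl)
    (fun _ => by rw [integral_mul_const, hf.integral_eq_one, one_mul])
    (by simpa using h.sub_const K)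

theorem integrable_indicator_Ioc (c : ℝ) :
    Integrable ((Ioc 0 c).indicator fun _ => (1 : ℝ)) :=
  (integrable_indicator_iff measurableSet_Ioc).2 (by simp)

theorem indicator_Ioc_eq_zero (c : ℝ) : ∀ s ≤ 0, (Ioc 0 c).indicator (fun _ => (1 : ℝ)) s = 0 :=
  fun _ hs => indicator_of_notMem (fun h => absurd h.1 (not_lt.2 hs)) _

theorem tendsto_sq_mul_localMass (hf : IsBddDensity f) {K c : ℝ} (hc : 0 < c)
    (h : Tendsto (fun x => x ^ 2 * f x) atTop (𝓝 K)) :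
    Tendsto (fun x => x ^ 2 * localMass hf.dist c x) atTop (𝓝 (c * K)) := by
  have h1 := hf.tendsto_sq_mul_integral_of_tendsto (integrable_indicator_Ioc c)
    (indicator_Ioc_eq_zero c) h
  rw [integral_indicator measurableSet_Ioc] at h1
  simpa [localMass_dist, hc.le] using h1

/-- Local masses inherit the quadratic decay with constant `c * K`, and self-convolution doubles
`K`; both requirements are then ratios of such limits. -/
theorem dist_mem_classSLoc (hf : IsBddDensity f) {K : ℝ} (hK : 0 < K)
    (h : Tendsto (fun x => x ^ 2 * f x) atTop (𝓝 K)) : hf.dist ∈ classSLoc := by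
  intro c hc
  have hm := hf.tendsto_sq_mul_localMass hc h
  have hcK : 0 < c * K := by positivity
  refine ⟨⟨hf.measurable_localMass c, fun x => measureReal_nonneg,
    eventually_pos_of_tendsto_sq_mul hcK hm, fun a => ?_⟩, ?_⟩
  · have := tendsto_div_of_tendsto_sq_mul hcK.ne' (tendsto_sq_mul_translate_of_tendsto hm a) hm
    rwa [div_self hcK.ne'] at this
  · have h2 := hf.selfConv.tendsto_sq_mul_localMass hc (hf.tendsto_sq_mul_selfConv_of_tendsto h)
    have h3 : Tendsto (fun x => x ^ 2 * (2 * localMass hf.dist c x)) atTop (𝓝 (c * (2 * K))) := by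
      have := hm.const_mul 2
      rw [mul_left_comm] at this
      exact this.congr fun x => by ring
    have h4 : c * (2 * K) ≠ 0 := by positivity
    have := tendsto_div_of_tendsto_sq_mul h4 h2 h3
    rw [div_self h4] at this
    rw [AsympEq, hf.convPow_two_dist]
    exact this

/-! ### The Fourier obstruction for oscillating tails. -/

/-- For a density with an oscillating quadratic tail, asymptotic invariance of a weighted average
under a half-period shift forces the weight to have a vanishing Fourier coefficient. -/
theorem fourier_eq_zero_of_tendsto_div (hf : IsBddDensity f) {K ω a : ℝ} {w : ℝ → ℝ} (hK : 0 < K)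
    (ha : 0 < a) (hωa : ω * a = Real.pi)
    (hfK : ∀ x > 1, x ^ 2 * f x = K * (1 + Real.cos (ω * x)))
    (hw : Integrable w) (hw0 : ∀ s ≤ 0, w s = 0)
    (hr : Tendsto (fun x => (∫ s, w s * f (x + a + s)) / ∫ s, w s * f (x + s)) atTop (𝓝 1)) :
    ∫ s, w s * Real.cos (ω * s) = 0 ∧ ∫ s, w s * Real.sin (ω * s) = 0 := by
  set H : ℝ → ℝ := fun x => K * (1 + Real.cos (ω * x)) with hH
  have hHB : ∀ x, |H x| ≤ 2 * K := fun x => by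
    have := Real.neg_one_le_cos (ω * x)
    have := Real.cos_le_one (ω * x)
    rw [hH, abs_of_nonneg (mul_nonneg hK.le (by linarith))]
    nlinarith
  have hHm : Measurable H := by fun_prop
  have hwc : Integrable fun s => w s * Real.cos (ω * s) :=
    integrable_mul_comp_of_bounded hw Real.measurable_cos Real.abs_cos_le_one
      (measurable_const_mul ω)
  have hws : Integrable fun s => w s * Real.sin (ω * s) :=
    integrable_mul_comp_of_bounded hw Real.measurable_sin Real.abs_sin_le_one
      (measurable_const_mul ω)
  set C := ∫ s, w s * Real.cos (ω * s) with hC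
  set S := ∫ s, w s * Real.sin (ω * s) with hS
  have hW : ∀ x, ∫ s, w s * H (x + s)
      = K * ((∫ s, w s) + Real.cos (ω * x) * C - Real.sin (ω * x) * S) := fun x => by
    have e : ∀ s, w s * H (x + s) = K * w s + K * Real.cos (ω * x) * (w s * Real.cos (ω * s))
        + -(K * Real.sin (ω * x)) * (w s * Real.sin (ω * s)) := fun s => by
      simp only [hH, mul_add ω, Real.cos_add]
      ring
    simp_rw [e]
    rw [integral_linear_combination hw hwc hws]
    ring
  have hper : Function.Periodic (fun x => ∫ s, w s * H (x + s)) (2 * a) := fun x => by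
    have : ω * (x + 2 * a) = ω * x + 2 * Real.pi := by rw [← hωa]; ring
    simp only [hW, this, Real.cos_add_two_pi, Real.sin_add_two_pi]
  have hWB : ∀ x, |∫ s, w s * H (x + s)| ≤ ∫ s, |w s| * (2 * K) := fun x => by
    rw [← Real.norm_eq_abs]
    refine norm_integral_le_of_norm_le (hw.abs.mul_const _) (ae_of_all _ fun s => ?_)
    rw [Real.norm_eq_abs, abs_mul]
    exact mul_le_mul_of_nonneg_left (hHB _) (abs_nonneg _)
  have hlim : Tendsto (fun x => x ^ 2 * f x - H x) atTop (𝓝 0) := by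
    refine tendsto_const_nhds.congr' ?_
    filter_upwards [eventually_gt_atTop 1] with x hx
    rw [hfK x hx, sub_self]
  have key := add_eq_of_tendsto_div (v := fun x => ∫ s, w s * f (x + s))
    (W := fun x => ∫ s, w s * H (x + s)) (by positivity) hper hWB
    (hf.tendsto_sq_mul_integral hHm hw hw0 hHB hlim) hr
  constructor
  -- A half-period shift flips the sign of the oscillating part. At `0` only `C` is visible, so `C =
  -- -C`.
  · have h0 : ∫ s, w s * H (0 + a + s) = ∫ s, w s * H (0 + s) := key 0
    rw [hW, hW] at h0
    simp only [zero_add, hωa, mul_zero, Real.cos_pi, Real.sin_pi, Real.cos_zero,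
      Real.sin_zero] at h0
    have := mul_left_cancel₀ hK.ne' h0
    linarith
  -- A quarter period is where only `S` is visible.
  · have h0 := key (a / 2)
    have e1 : ω * (a / 2) = Real.pi / 2 := by rw [← hωa]; ring
    have e2 : ω * (a / 2 + a) = Real.pi / 2 + Real.pi := by rw [← hωa]; ring
    simp only [hW, e1, e2, Real.cos_add_pi, Real.sin_add_pi, Real.cos_pi_div_two,
      Real.sin_pi_div_two] at h0
    have := mul_left_cancel₀ hK.ne' h0
    linarith

/-- Over the half period `(0, c]` the sine does not change sign: its integral is `2 / ω`, whereas
the cosine integral vanishes and gives no obstruction. -/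
theorem dist_notMem_classLDelta (hf : IsBddDensity f) {K ω c : ℝ} (hK : 0 < K) (hc : 0 < c)
    (hωc : ω * c = Real.pi) (hfK : ∀ x > 1, x ^ 2 * f x = K * (1 + Real.cos (ω * x))) :
    hf.dist ∉ classLDelta c := by
  rintro ⟨-, -, -, hr⟩
  have hr := hr c
  simp only [AsympEq, localMass_dist] at hr
  have h := (hf.fourier_eq_zero_of_tendsto_div hK hc hωc hfK (integrable_indicator_Ioc c)
    (indicator_Ioc_eq_zero c) hr).2
  have e : ∀ s, (Ioc 0 c).indicator (fun _ => (1 : ℝ)) s * Real.sin (ω * s)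
      = (Ioc 0 c).indicator (fun s => Real.sin (ω * s)) s := fun s => by
    simp [indicator]
  have hω : ω ≠ 0 := by
    rintro rfl
    rw [zero_mul] at hωc
    exact Real.pi_ne_zero hωc.symm
  simp_rw [e] at h
  rw [integral_indicator measurableSet_Ioc, ← intervalIntegral.integral_of_le hc.le,
    intervalIntegral.integral_comp_mul_left (fun u => Real.sin u) hω, hωc, integral_sin] at h
  norm_num at h
  exact hω h

/-! ### Exponential tilting and the class `L(γ) ∩ M(γ)`. -/

/-- The weight `e ^ (-γ s)` on the positive half-line. -/
noncomputable def expWeight (γ : ℝ) : ℝ → ℝ := (Ioi 0).indicator fun s => Real.exp (-γ * s)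

theorem integrable_expWeight {γ : ℝ} (hγ : 0 < γ) : Integrable (expWeight γ) :=
  (integrable_indicator_iff measurableSet_Ioi).2 (integrableOn_exp_mul_Ioi (by linarith) 0)

theorem expWeight_eq_zero (γ : ℝ) : ∀ s ≤ 0, expWeight γ s = 0 :=
  fun _ hs => indicator_of_notMem (not_lt.2 hs) _

theorem integral_expWeight_pos {γ : ℝ} (hγ : 0 < γ) : 0 < ∫ s, expWeight γ s := by
  rw [expWeight, integral_indicator measurableSet_Ioi, integral_exp_mul_Ioi (by linarith) 0]
  simpa using hγ

/-- The integral is the real part of `1 / (γ - i ω)`, namely `γ / (γ ^ 2 + ω ^ 2)`. -/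
theorem integral_expWeight_mul_cos_ne_zero {γ : ℝ} (hγ : 0 < γ) (ω : ℝ) :
    ∫ s, expWeight γ s * Real.cos (ω * s) ≠ 0 := by
  have hre : ((-γ : ℂ) + ω * Complex.I).re < 0 := by simpa using hγ
  have h1 := integral_exp_mul_complex_Ioi hre 0
  have h2 := integral_re (integrableOn_exp_mul_complex_Ioi hre 0)
  rw [h1] at h2
  have e : ∀ s, expWeight γ s * Real.cos (ω * s) = (Ioi 0).indicator
      (fun s : ℝ => RCLike.re (Complex.exp (((-γ : ℂ) + ω * Complex.I) * s))) s := fun s => by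
    simp only [expWeight, indicator]
    split_ifs <;> simp [Complex.exp_re]
  simp_rw [e]
  rw [integral_indicator measurableSet_Ioi, h2]
  have h3 : (-γ : ℂ) + ω * Complex.I ≠ 0 := fun h => by simp [h] at hre
  have h4 : 0 < Complex.normSq ((-γ : ℂ) + ω * Complex.I) := Complex.normSq_pos.2 h3
  simp only [Complex.ofReal_zero, mul_zero, Complex.exp_zero, RCLike.re_eq_complex_re,
    Complex.div_re]
  simp [hγ.ne', h3]

variable {g : ℝ → ℝ}

theorem tail_tilt (hg : IsBddDensity g) {γ D : ℝ}
    (hgf : ∀ x, g x = D * (Real.exp (-γ * x) * f x)) (x : ℝ) :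
    tail hg.dist x = D * Real.exp (-γ * x) * ∫ s, expWeight γ s * f (x + s) := by
  rw [tail_dist, ← integral_indicator measurableSet_Ioi, ← integral_const_mul]
  refine integral_congr_ae (ae_of_all _ fun s => ?_)
  simp only [indicator, expWeight]
  split_ifs
  · rw [hgf, mul_add, Real.exp_add]; ring
  · simp

/-- The factor `e ^ (-γ a)` in the definition of `L(γ)` is exactly what the tilt produces, so
membership reduces to shift invariance of a weighted average of `f`. -/
theorem tail_tilt_div (hg : IsBddDensity g) {γ D : ℝ} (hD : 0 < D)
    (hgf : ∀ x, g x = D * (Real.exp (-γ * x) * f x)) (a x : ℝ) :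
    tail hg.dist (x + a) / (Real.exp (-γ * a) * tail hg.dist x)
      = (∫ s, expWeight γ s * f (x + a + s)) / ∫ s, expWeight γ s * f (x + s) := by
  rw [hg.tail_tilt hgf, hg.tail_tilt hgf, mul_add, Real.exp_add, ← mul_assoc (Real.exp (-γ * a)),
    show D * (Real.exp (-γ * x) * Real.exp (-γ * a))
      = Real.exp (-γ * a) * (D * Real.exp (-γ * x)) by ring]
  exact mul_div_mul_left _ _ (by positivity)

theorem tilt_mem_classL_inter_classM (hf : IsBddDensity f) (hg : IsBddDensity g) {γ D K : ℝ}
    (hγ : 0 < γ) (hD : 0 < D) (hK : 0 < K) (hgf : ∀ x, g x = D * (Real.exp (-γ * x) * f x))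
    (h : Tendsto (fun x => x ^ 2 * f x) atTop (𝓝 K)) :
    hg.dist ∈ classL γ ∩ classM γ := by
  have h1 := hf.tendsto_sq_mul_integral_of_tendsto (integrable_expWeight hγ)
    (expWeight_eq_zero γ) h
  have hK' : 0 < (∫ s, expWeight γ s) * K := mul_pos (integral_expWeight_pos hγ) hK
  refine ⟨⟨fun x => ?_, fun a => ?_⟩, ?_⟩
  · obtain ⟨y, hy, hxy⟩ := ((eventually_pos_of_tendsto_sq_mul hK' h1).and
      (eventually_ge_atTop x)).exists
    have hty : 0 < tail hg.dist y := by
      rw [hg.tail_tilt hgf]; positivity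
    exact hty.trans_le (measureReal_mono (Ioi_subset_Ioi hxy))
  · simp only [AsympEq, hg.tail_tilt_div hD hgf]
    have := tendsto_div_of_tendsto_sq_mul hK'.ne' (tendsto_sq_mul_translate_of_tendsto h1 a) h1
    rwa [div_self hK'.ne'] at this
  · change Integrable _ (hg.dist : Measure ℝ)
    rw [coe_dist, integrable_withDensity_iff_integrable_smul' hg.measurable.ennreal_ofReal
      (ae_of_all _ fun _ => ENNReal.ofReal_lt_top)]
    refine (hf.integrable.const_mul D).congr (ae_of_all _ fun x => ?_)
    simp only
    rw [ENNReal.toReal_ofReal (hg.nonneg x), smul_eq_mul, hgf]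
    rw [show D * (Real.exp (-γ * x) * f x) * Real.exp (γ * x)
      = D * f x * (Real.exp (-γ * x) * Real.exp (γ * x)) by ring, ← Real.exp_add]
    simp

theorem tilt_notMem_classL (hf : IsBddDensity f) (hg : IsBddDensity g) {γ D K ω a : ℝ}
    (hγ : 0 < γ) (hD : 0 < D) (hK : 0 < K) (ha : 0 < a) (hωa : ω * a = Real.pi)
    (hgf : ∀ x, g x = D * (Real.exp (-γ * x) * f x))
    (hfK : ∀ x > 1, x ^ 2 * f x = K * (1 + Real.cos (ω * x))) :
    hg.dist ∉ classL γ := by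
  rintro ⟨-, hr⟩
  have hr := hr a
  simp only [AsympEq, hg.tail_tilt_div hD hgf] at hr
  exact integral_expWeight_mul_cos_ne_zero hγ ω (hf.fourier_eq_zero_of_tendsto_div hK ha hωa hfK
    (integrable_expWeight hγ) (expWeight_eq_zero γ) hr).1

/-- The exponential tilt of a bounded density vanishing near `-∞`. -/
theorem exists_tilt (hf : IsBddDensity f) {γ L : ℝ} (hγ : 0 < γ) (hL : ∀ x ≤ L, f x = 0) :
    ∃ D : ℝ, 0 < D ∧ IsBddDensity fun x => D * (Real.exp (-γ * x) * f x) := by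
  -- The tilt factor is unbounded near `-∞`; vanishing of `f` below `L` confines it to `e ^ (-γ L)`.
  have hle : ∀ x, Real.exp (-γ * x) * f x ≤ Real.exp (-γ * L) * f x := fun x => by
    rcases le_total x L with hx | hx
    · simp [hL x hx]
    · exact mul_le_mul_of_nonneg_right (Real.exp_le_exp.2 (by nlinarith)) (hf.nonneg x)
  have h0 : ∀ x, 0 ≤ Real.exp (-γ * x) * f x := fun x =>
    mul_nonneg (Real.exp_pos _).le (hf.nonneg x)
  have hm : Measurable fun x => Real.exp (-γ * x) * f x :=
    (Measurable.mul (by fun_prop) hf.measurable)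
  have hi : Integrable fun x => Real.exp (-γ * x) * f x :=
    (hf.integrable.const_mul (Real.exp (-γ * L))).mono' hm.aestronglyMeasurable
      (ae_of_all _ fun x => by rw [Real.norm_eq_abs, abs_of_nonneg (h0 x)]; exact hle x)
  have hpos : 0 < ∫ x, Real.exp (-γ * x) * f x := by
    rw [integral_pos_iff_support_of_nonneg h0 hi]
    have h1 : 0 < ∫ x, f x := by rw [hf.integral_eq_one]; exact one_pos
    rw [integral_pos_iff_support_of_nonneg hf.nonneg hf.integrable] at h1
    convert h1 using 2
    ext x
    simp [Real.exp_ne_zero]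
  refine ⟨(∫ x, Real.exp (-γ * x) * f x)⁻¹, inv_pos.2 hpos, hm.const_mul _,
    fun x => mul_nonneg (inv_pos.2 hpos).le (h0 x), hi.const_mul _, ?_, ?_⟩
  · rw [integral_const_mul, inv_mul_cancel₀ hpos.ne']
  · obtain ⟨B, hB⟩ := hf.bdd
    exact ⟨_, fun x => mul_le_mul_of_nonneg_left ((hle x).trans
      (mul_le_mul_of_nonneg_left (hB x) (Real.exp_pos _).le)) (inv_pos.2 hpos).le⟩

end IsBddDensity

/-- Multiplicativity of the exponential along `x = y + (x - y)` lets the tilt factor leave the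
integral. -/
theorem selfConv_tilt (f : ℝ → ℝ) (γ D x : ℝ) :
    selfConv (fun x => D * (Real.exp (-γ * x) * f x)) x
      = D ^ 2 * (Real.exp (-γ * x) * selfConv f x) := by
  simp only [selfConv]
  rw [← integral_const_mul, ← integral_const_mul]
  refine integral_congr_ae (ae_of_all _ fun y => ?_)
  have : Real.exp (-γ * x) = Real.exp (-γ * y) * Real.exp (-γ * (x - y)) := by
    rw [← Real.exp_add]; ring_nf
  simp only [this]
  ring

end ConvRoots

/-! ### The counterexamples. -/

theorem corollary1p1 (c γ : ℝ) (hc : 0 < c) (hγ : 0 < γ) :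
    ¬ ConvRoots.ClosedUnderConvRoots ConvRoots.classSLoc ∧
    ¬ ConvRoots.ClosedUnderConvRoots (ConvRoots.classSDelta c) ∧
    ¬ ConvRoots.ClosedUnderConvRoots (ConvRoots.classL γ ∩ ConvRoots.classM γ) ∧
    ¬ ConvRoots.ClosedUnderConvRoots ConvRoots.classLLoc ∧
    ¬ ConvRoots.ClosedUnderConvRoots (ConvRoots.classLDelta c) := by
  have hω : 0 < Real.pi / c := div_pos Real.pi_pos hc
  have hωc : Real.pi / c * c = Real.pi := div_mul_cancel₀ _ hc.ne'
  obtain ⟨f, K, L, hf, hK, hL, hfK, hcos, hsin⟩ := ConvRoots.exists_density hω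
  have hconv : Tendsto (fun x => x ^ 2 * ConvRoots.selfConv f x) atTop (𝓝 (2 * K)) := by
    refine hf.tendsto_sq_mul_selfConv (H := fun x => K * (1 + Real.cos (Real.pi / c * x)))
      (B := 2 * K) (by fun_prop) (fun x => ?_) (fun x => ?_) ?_
    · have := Real.neg_one_le_cos (Real.pi / c * x)
      have := Real.cos_le_one (Real.pi / c * x)
      rw [abs_of_nonneg (mul_nonneg hK.le (by linarith))]
      nlinarith
    · have hfc := ConvRoots.integrable_mul_comp_of_bounded hf.integrable Real.measurable_cos
        Real.abs_cos_le_one (measurable_const_mul (Real.pi / c))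
      have hfs := ConvRoots.integrable_mul_comp_of_bounded hf.integrable Real.measurable_sin
        Real.abs_sin_le_one (measurable_const_mul (Real.pi / c))
      -- After expansion, the two oscillating terms carry the vanishing Fourier coefficients of `f`,
      -- and the constant `K` remains.
      have e : ∀ y, f y * (K * (1 + Real.cos (Real.pi / c * (x - y)))) = K * f y
          + K * Real.cos (Real.pi / c * x) * (f y * Real.cos (Real.pi / c * y))
          + K * Real.sin (Real.pi / c * x) * (f y * Real.sin (Real.pi / c * y)) := fun y => by
        rw [mul_sub (Real.pi / c), Real.cos_sub]; ring
      simp_rw [e]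
      rw [ConvRoots.integral_linear_combination hf.integrable hfc hfs, hcos, hsin,
        hf.integral_eq_one]
      ring
    · refine tendsto_const_nhds.congr' ?_
      filter_upwards [eventually_gt_atTop 1] with x hx
      rw [hfK x hx, sub_self]
  have hS : ConvRoots.convPow hf.dist 2 ∈ ConvRoots.classSLoc := by
    rw [hf.convPow_two_dist]
    exact hf.selfConv.dist_mem_classSLoc (by positivity) hconv
  have hN := hf.dist_notMem_classLDelta hK hc hωc hfK
  refine ⟨fun h => hN (h _ ⟨2, one_le_two, hS⟩ c hc).1,
    fun h => hN (h _ ⟨2, one_le_two, hS c hc⟩).1, fun h => ?_,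
    fun h => hN (h _ ⟨2, one_le_two, fun d hd => (hS d hd).1⟩ c hc),
    fun h => hN (h _ ⟨2, one_le_two, (hS c hc).1⟩)⟩
  obtain ⟨D, hD, hg⟩ := hf.exists_tilt hγ hL
  refine hf.tilt_notMem_classL hg hγ hD hK hc hωc (fun _ => rfl) hfK
    (h _ ⟨2, one_le_two, ?_⟩).1
  rw [hg.convPow_two_dist]
  exact hf.selfConv.tilt_mem_classL_inter_classM hg.selfConv hγ (by positivity) (by positivity)
    (ConvRoots.selfConv_tilt f γ D) hconv
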